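/- All graphs are finite and simple. For a graph $H$, an ordering is a bijection $\alpha:V(H)\to\{1,\dots,|V(H)|\}$, its profile is $\sum_{v}(\alpha(v)-\min\{\alpha(u): u\in N[v]\})$, and $\mathrm{prf}(H)$ is the minimum of the profiles of all orderings of $H$. A weighted graph $G=(V,E,\rho)$ is a graph with positive integral vertex weights $\rho(v)$ such that every vertex of degree greater than one has weight $1$. Its weight is $\rho(G)=\sum_{v\in V}\rho(v)$. It represents the unweighted graph $G^u$ obtained by replacing each vertex $v$ by $\rho(v)$ pairwise nonadjacent copies, copies of distinct vertices being adjacent iff the vertices are adjacent in $G$; its profile is $\mathrm{prf}(G)=\mathrm{prf}(G^u)$. Let $N_1(x)$ denote the set of degree-$1$ neighbours of $x$. For a connected $G$, the order of a bridge $e$ is $\min\{\rho(G_1),\rho(G_2)\}$, where $G_1,G_2$ are the components of $G-e$. A bridgeless component is a maximal connected induced subgraph without bridges. For an integer $k$, a vertex $v$ is $k$-suppressible if (a) $v$ alone forms a bridgeless component of $G$; (b) $v$ has degree $2$ or $3$; (c) exactly two bridges $xv$, $yv$ of order at least $k+2$ join $v$ to vertices $x,y$ of degree other than $1$; (d) if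 there is a third edge $vw$, then $w$ has degree $1$. Rule A: if $N_1(x)=\{v_1,\dots,v_r\}$ with $r\ge 2$, delete $v_2,\dots,v_r$ and give $v_1$ the weight $\sum_{i=1}^r\rho(v_i)$; all other weights are unchanged. Rule B (with respect to $k$): if $v$ is $k$-suppressible and $xv,yv$ are the two bridges in (c), delete $\{v\}\cup N_1(v)$ and add the edge $xy$; weights are unchanged. Theorem. Let $G=(V,E,\rho)$ be a connected weighted graph with $n=|V|$ and $m=|E|$, and let $k$ be a positive integer such that $\mathrm{prf}(G)\le\rho(G)-1+k$. Then Rule A can be applied to $G$, or Rule B can be applied to $G$ with respect to $k$, or $n\le 12k+6$ and $m\le 13k+5$. -/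

import Mathlib

/-! ### The profile of a graph -/

/-- The profile of the vertex `z` in the ordering `α`: the difference between `α z` and the least
value of `α` on the closed neighbourhood of `z`.  (Positions are numbered from `0` instead of `1`,
which does not change differences; the subtraction never truncates, since `z` itself belongs to
its closed neighbourhood.) -/
noncomputable def SimpleGraph.vertexProfile {W : Type*} [Fintype W] (H : SimpleGraph W)
    (α : W ≃ Fin (Fintype.card W)) (z : W) : ℕ :=
  (α z : ℕ) - sInf {p : ℕ | ∃ w : W, (w = z ∨ H.Adj z w) ∧ p = (α w : ℕ)}

/-- The profile of the ordering `α`. -/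
noncomputable def SimpleGraph.orderingProfile {W : Type*} [Fintype W] (H : SimpleGraph W)
    (α : W ≃ Fin (Fintype.card W)) : ℕ :=
  ∑ z : W, H.vertexProfile α z

/-- The profile of a graph: the minimum of the profiles of its orderings. -/
noncomputable def SimpleGraph.profile {W : Type*} [Fintype W] (H : SimpleGraph W) : ℕ :=
  sInf (Set.range fun α : W ≃ Fin (Fintype.card W) => H.orderingProfile α)

/-- A bridgeless component, given by its vertex set: a maximal connected induced subgraph
without bridges. -/
def SimpleGraph.IsBridgelessComponent {W : Type*} (H : SimpleGraph W) (S : Set W) : Prop :=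
  Maximal (fun T : Set W => (H.induce T).Connected ∧
    ∀ e ∈ (H.induce T).edgeSet, ¬ (H.induce T).IsBridge e) S

/-! ### Weighted graphs -/

/-- Weighted graphs: vertices have positive integral weights, and vertices of degree greater than
one have weight `1`. -/
structure WeightedGraph (V : Type*) where
  graph : SimpleGraph V
  weight : V → ℕ
  weight_pos : ∀ v, 0 < weight v
  weight_eq_one : ∀ v, 1 < (graph.neighborSet v).ncard → weight v = 1

namespace WeightedGraph

/-- The degree of a vertex (of a finite graph). -/
noncomputable def deg {V : Type*} (G : WeightedGraph V) (v : V) : ℕ :=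
  (G.graph.neighborSet v).ncard

/-- The neighbours of degree `1` of the vertex `x`. -/
def leaves {V : Type*} (G : WeightedGraph V) (x : V) : Set V :=
  {w | G.graph.Adj x w ∧ G.deg w = 1}

/-- The total weight of a set of vertices. -/
noncomputable def weightOf {V : Type*} [Fintype V] (G : WeightedGraph V) (S : Set V) : ℕ :=
  ∑ v : V, S.indicator G.weight v

/-- The weight of the weighted graph. -/
def totalWeight {V : Type*} [Fintype V] (G : WeightedGraph V) : ℕ :=
  ∑ v : V, G.weight v

/-- The unweighted graph that the weighted graph represents: each vertex `v` is replaced with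
`weight v` copies, adjacent to the copies of the neighbours of `v`.  Only vertices of degree `1`
may have a weight other than `1` (apart from an isolated vertex), so in a connected graph with at
least three vertices this replaces every vertex `v` of degree `1`, with neighbour `w`, by
`weight v` vertices of degree `1` adjacent to `w`, and changes nothing else. -/
def expand {V : Type*} (G : WeightedGraph V) : SimpleGraph (Σ v : V, Fin (G.weight v)) :=
  G.graph.comap Sigma.fst

/-- The profile of a weighted graph is the profile of the unweighted graph it represents. -/
noncomputable def profile {V : Type*} [Fintype V] (G : WeightedGraph V) : ℕ :=
  G.expand.profile

/-- The edge joining `u` and `v` is present and is a bridge. -/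
def IsBridgeEdge {V : Type*} (G : WeightedGraph V) (u v : V) : Prop :=
  G.graph.Adj u v ∧ G.graph.IsBridge s(u, v)

/-- The vertices on the side of `u` after deletion of the edge `uv`. -/
def side {V : Type*} (G : WeightedGraph V) (u v : V) : Set V :=
  {w | (G.graph.deleteEdges {s(u, v)}).Reachable u w}

/-- The order of the bridge `uv` of a connected weighted graph: the smaller of the weights of the
two components obtained by deleting it. -/
noncomputable def bridgeOrder {V : Type*} [Fintype V] (G : WeightedGraph V) (u v : V) : ℕ :=
  min (G.weightOf (G.side u v)) (G.weightOf (G.side v u))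

/-- The neighbours `u` of `v` of degree other than `1` such that `vu` is a bridge of order at
least `k + 2`. -/
def heavyNeighbors {V : Type*} [Fintype V] (G : WeightedGraph V) (k : ℕ) (v : V) : Set V :=
  {u | G.IsBridgeEdge v u ∧ G.deg u ≠ 1 ∧ k + 2 ≤ G.bridgeOrder v u}

/-- The vertex `v` is `k`-suppressible. -/
def IsSuppressible {V : Type*} [Fintype V] (G : WeightedGraph V) (k : ℕ) (v : V) : Prop :=
  G.graph.IsBridgelessComponent {v} ∧
  (G.deg v = 2 ∨ G.deg v = 3) ∧
  (G.heavyNeighbors k v).ncard = 2 ∧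
  ∀ w, G.graph.Adj v w → w ∉ G.heavyNeighbors k v → G.deg w = 1

/-- `G₀`, a weighted graph on the set `S` of vertices of `G`, results from `G` by merging the
degree-`1` neighbours (at least two) of some vertex `x` into one of them, `v₁`, which receives
the sum of their weights. -/
def MergesTo {V : Type*} [Fintype V] (G : WeightedGraph V) {S : Set V}
    (G₀ : WeightedGraph S) : Prop :=
  ∃ x v₁ : V, 2 ≤ (G.leaves x).ncard ∧ v₁ ∈ G.leaves x ∧
    S = (G.leaves x \ {v₁})ᶜ ∧
    G₀.graph = G.graph.induce S ∧
    ∀ u : S, ((u : V) = v₁ → G₀.weight u = G.weightOf (G.leaves x)) ∧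
      ((u : V) ≠ v₁ → G₀.weight u = G.weight u)

/-- `G'`, a weighted graph on the set `S` of vertices of `G`, results from `G` by suppressing a
`k`-suppressible vertex `v`: with `xv` and `yv` the two bridges of order at least `k + 2` to
vertices of degree other than `1`, the vertex `v` and its degree-`1` neighbours are removed and
the edge `xy` is added. -/
def SuppressesTo {V : Type*} [Fintype V] (G : WeightedGraph V) (k : ℕ) {S : Set V}
    (G' : WeightedGraph S) : Prop :=
  ∃ v x y : V, G.IsSuppressible k v ∧ x ≠ y ∧ G.heavyNeighbors k v = {x, y} ∧
    S = (insert v (G.leaves v))ᶜ ∧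
    (∀ a b : S, G'.graph.Adj a b ↔
      G.graph.Adj a b ∨ ((a : V) = x ∧ (b : V) = y) ∨ ((a : V) = y ∧ (b : V) = x)) ∧
    ∀ a : S, G'.weight a = G.weight a

/-- Merging degree-`1` neighbours can be applied to `G`. -/
def MergeApplies {V : Type*} [Fintype V] (G : WeightedGraph V) : Prop :=
  ∃ (S : Set V) (G₀ : WeightedGraph S), G.MergesTo G₀

/-- Suppression of a `k`-suppressible vertex can be applied to `G`. -/
def SuppressApplies {V : Type*} [Fintype V] (G : WeightedGraph V) (k : ℕ) : Prop :=
  ∃ (S : Set V) (G' : WeightedGraph S), G.SuppressesTo k G'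

end WeightedGraph

/-!
The idea is to read the profile as a sum of boundary sizes. For an ordering `α` of a graph with
`N` vertices, let `d i` be the number of vertices outside the first `i` vertices that have a
neighbour among them. Then the profile of `α` is `∑ d i` (`SimpleGraph.sum_card_boundary`). In a
connected graph `d i ≥ 1` for `0 < i < N`, so a profile of at most `N - 1 + k` leaves at most `k`
indices with `d i ≥ 2` (`SimpleGraph.card_large_boundary_le`).

Fix an optimal ordering of the expanded graph and consider the step that places the vertex `p` at
position `i`, where `d i = d (i + 1) = 1`. Either `p` is the only boundary vertex, and then the edge
from `p` to the next boundary vertex is the only edge across the cut after `p`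
(`isHeavyCut_of_boundary`); or `p` is a vertex of degree `1` whose neighbour is the boundary vertex
(`SimpleGraph.eq_of_adj_of_notMem_boundary`). If two successive steps of the first kind, not too
close to the ends of the ordering, are not separated by an index with `d i ≥ 2`, then the vertex
placed in the second one has only bridges around it and is suppressible
(`exists_isSuppressible`). So, unless a vertex can be suppressed, there are at most `k + 1` such
steps. If no two vertices of degree `1` have a common neighbour, then two steps of the second kind
with only steps of the second kind between them place copies of the same vertex
(`fst_eq_of_forall_notMem_boundary`), so that at most `2 * k + 2` of these steps place the first
copy of a vertex. With the `2 * k + 4` steps near the ends of the ordering and the `2 * k` steps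
next to an index with `d i ≥ 2` this gives at most `7 * k + 7` vertices
(`card_le_of_orderingProfile_le`), which suffices as `k` is positive.

The number of edges follows: every edge of the expanded graph is counted in the profile, and that
graph has at least as many additional edges, compared with `G`, as it has additional vertices
(`ncard_edgeSet_add_le`).
-/

namespace SimpleGraph

/-! ### Boundaries of the initial segments of an ordering -/

section Ordering

variable {W : Type*} [Fintype W] (H : SimpleGraph W) (α : W ≃ Fin (Fintype.card W))

open Classical in
/-- The vertices outside the initial segment `{q | α q < i}` of the ordering `α` that have a
neighbour in it. -/
noncomputable def boundary (i : ℕ) : Finset W :=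
  {p | i ≤ (α p : ℕ) ∧ ∃ q, H.Adj p q ∧ (α q : ℕ) < i}

variable {H α}

lemma mem_boundary {i : ℕ} {p : W} :
    p ∈ H.boundary α i ↔ i ≤ (α p : ℕ) ∧ ∃ q, H.Adj p q ∧ (α q : ℕ) < i := by
  classical
  simp [boundary]

lemma exists_position {i : ℕ} (hi : i < Fintype.card W) : ∃ p, (α p : ℕ) = i :=
  ⟨α.symm ⟨i, hi⟩, by simp⟩

lemma eq_of_position_eq {p q : W} (h : (α p : ℕ) = α q) : p = q :=
  α.injective (Fin.ext h)

variable (H α)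

/-- `p` lies in the boundary of exactly those initial segments that contain a neighbour of `p`
but not `p` itself, and there are `vertexProfile p` of them. -/
lemma card_filter_mem_boundary (p : W) [DecidablePred fun i => p ∈ H.boundary α i] :
    ((Finset.range (Fintype.card W)).filter fun i => p ∈ H.boundary α i).card
      = H.vertexProfile α p := by
  set A : Set ℕ := {j : ℕ | ∃ w : W, (w = p ∨ H.Adj p w) ∧ j = (α w : ℕ)} with hA
  have hne : A.Nonempty := ⟨α p, p, Or.inl rfl, rfl⟩
  have : ((Finset.range (Fintype.card W)).filter fun i => p ∈ H.boundary α i)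
      = Finset.Ioc (sInf A) (α p : ℕ) := by
    ext i
    simp only [Finset.mem_filter, Finset.mem_range, mem_boundary, Finset.mem_Ioc]
    constructor
    · rintro ⟨-, h1, q, hq, hqi⟩
      exact ⟨lt_of_le_of_lt (Nat.sInf_le ⟨q, Or.inr hq, rfl⟩) hqi, h1⟩
    · rintro ⟨h1, h2⟩
      obtain ⟨w, hw, hwe⟩ := Nat.sInf_mem hne
      refine ⟨lt_of_le_of_lt h2 (α p).isLt, h2, w, ?_, by omega⟩
      rcases hw with rfl | hw
      · omega
      · exact hw
  rw [this, Nat.card_Ioc]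
  rfl

lemma sum_card_boundary :
    ∑ i ∈ Finset.range (Fintype.card W), (H.boundary α i).card = H.orderingProfile α := by
  classical
  have := Finset.sum_card_bipartiteAbove_eq_sum_card_bipartiteBelow
    (s := Finset.range (Fintype.card W)) (t := (Finset.univ : Finset W))
    (fun i p => p ∈ H.boundary α i)
  simp only [Finset.bipartiteAbove, Finset.bipartiteBelow, card_filter_mem_boundary] at this
  rw [orderingProfile, ← this]
  refine Finset.sum_congr rfl fun i _ => ?_
  simp

lemma exists_orderingProfile_eq : ∃ α, H.orderingProfile α = H.profile :=
  Nat.sInf_mem (Set.range_nonempty_iff_nonempty.2 ⟨Fintype.equivFin W⟩)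

/-- The earlier neighbours of a vertex occupy distinct positions between the first of them and
the vertex, so `H` has at most as many edges (counted as ordered pairs) as the profile. -/
lemma card_back_pairs_le [DecidablePred fun e : W × W => H.Adj e.1 e.2 ∧ α e.2 < α e.1] :
    (Finset.univ.filter fun e : W × W => H.Adj e.1 e.2 ∧ α e.2 < α e.1).card
      ≤ H.orderingProfile α := by
  classical
  rw [Finset.card_eq_sum_card_fiberwise (f := Prod.fst) (t := Finset.univ) (by simp)]
  refine Finset.sum_le_sum fun p _ => ?_
  rw [← card_filter_mem_boundary]
  refine Finset.card_le_card_of_injOn (fun e => (α e.2 : ℕ) + 1) ?_ ?_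
  · rintro ⟨a, q⟩ h
    simp only [Finset.coe_filter, Finset.mem_filter, Finset.mem_univ, true_and,
      Set.mem_ofPred_eq, Finset.mem_range, mem_boundary] at h ⊢
    obtain ⟨⟨h1, h2⟩, rfl⟩ := h
    have h3 : (α q : ℕ) < α a := h2
    exact ⟨lt_of_le_of_lt h3 (α a).isLt, h3, q, h1, by omega⟩
  · rintro ⟨a, q⟩ h ⟨b, r⟩ h' heq
    simp only [Finset.coe_filter, Finset.mem_filter, Finset.mem_univ, true_and,
      Set.mem_ofPred_eq] at h h' heq
    rw [eq_of_position_eq (α := α) (p := q) (q := r) (by omega), h.2, h'.2]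

variable {H α}

/-- In a connected graph an edge leaves every nonempty proper set of vertices. -/
lemma Connected.exists_adj_mem_notMem {X : Type*} {K : SimpleGraph X} (hK : K.Connected)
    {S : Set X} {a b : X} (ha : a ∈ S) (hb : b ∉ S) : ∃ c ∈ S, ∃ d ∉ S, K.Adj c d := by
  obtain ⟨w⟩ := hK.preconnected a b
  obtain ⟨d, -, h1, h2⟩ := w.exists_boundary_dart S ha hb
  exact ⟨d.fst, h1, d.snd, h2, d.adj⟩

lemma boundary_nonempty (hH : H.Connected) {i : ℕ} (h0 : 0 < i) (hi : i < Fintype.card W) :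
    (H.boundary α i).Nonempty := by
  obtain ⟨a, ha⟩ := exists_position (α := α) (h0.trans hi)
  obtain ⟨b, hb⟩ := exists_position (α := α) hi
  obtain ⟨c, hc, d, hd, hcd⟩ := hH.exists_adj_mem_notMem (S := {q | (α q : ℕ) < i})
    (a := a) (b := b) (by simp; omega) (by simp; omega)
  exact ⟨d, mem_boundary.2 ⟨by simpa using hd, c, hcd.symm, hc⟩⟩

/-- Since every boundary but the first has at least one vertex, few of them have more than one
if the profile is close to its least possible value. -/
lemma card_large_boundary_le (hH : H.Connected) {k : ℕ}
    (hα : H.orderingProfile α + 1 ≤ Fintype.card W + k) :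
    ((Finset.range (Fintype.card W)).filter fun i => 2 ≤ (H.boundary α i).card).card ≤ k := by
  have h := sum_card_boundary H α
  have h0 : (H.boundary α 0).card = 0 := by
    rw [Finset.card_eq_zero, Finset.eq_empty_iff_forall_notMem]
    intro p hp
    obtain ⟨-, q, -, hq⟩ := mem_boundary.1 hp
    omega
  have hpos : 0 < Fintype.card W := Fintype.card_pos_iff.2 hH.nonempty
  have key : ∑ i ∈ Finset.range (Fintype.card W),
      ((if 2 ≤ (H.boundary α i).card then 1 else 0) + 1)
      ≤ ∑ i ∈ Finset.range (Fintype.card W),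
        ((H.boundary α i).card + if i = 0 then 1 else 0) := by
    refine Finset.sum_le_sum fun i hi => ?_
    rcases Nat.eq_zero_or_pos i with rfl | hi0
    · simp [h0]
    · have := (boundary_nonempty (α := α) hH hi0 (Finset.mem_range.1 hi)).card_pos
      rw [if_neg hi0.ne']
      split_ifs <;> omega
  rw [Finset.sum_add_distrib, Finset.sum_add_distrib, h, ← Finset.card_filter] at key
  simp only [Finset.sum_const, Finset.card_range, smul_eq_mul, mul_one, Finset.sum_ite_eq',
    Finset.mem_range, hpos, if_true] at key
  omega

/-- As long as no boundary vertex is placed and the boundaries are singletons, the boundary does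
not change. -/
lemma boundary_eq_of_forall_notMem {z : W} {i j : ℕ} (hij : i ≤ j)
    (hi : H.boundary α i = {z})
    (hcard : ∀ l, i ≤ l → l ≤ j → (H.boundary α l).card = 1)
    (hstep : ∀ p, i ≤ (α p : ℕ) → (α p : ℕ) < j → p ∉ H.boundary α (α p)) :
    H.boundary α j = {z} := by
  induction j, hij using Nat.le_induction with
  | base => exact hi
  | succ j hij ih =>
    have hj := ih (fun l h1 h2 => hcard l h1 (by omega)) fun p h1 h2 => hstep p h1 (by omega)
    have hz : z ∈ H.boundary α j := by simp [hj]
    obtain ⟨h1, q, h2, h3⟩ := mem_boundary.1 hz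
    have hne : (α z : ℕ) ≠ j := by
      intro h
      exact hstep z (by omega) (by omega) (h ▸ hz)
    have hz' : z ∈ H.boundary α (j + 1) := mem_boundary.2 ⟨by omega, q, h2, by omega⟩
    obtain ⟨y, hy⟩ := Finset.card_eq_one.1 (hcard (j + 1) (by omega) le_rfl)
    rw [hy, Finset.mem_singleton] at hz'
    rw [hy, hz']

/-- A vertex that is placed while it is not in the boundary, and after which the boundary is
`{z}`, has no neighbour other than `z`. -/
lemma eq_of_adj_of_notMem_boundary {z p q : W} (hp : p ∉ H.boundary α (α p))
    (hz : H.boundary α (α p + 1) = {z}) (hq : H.Adj p q) : q = z := by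
  have h1 : ¬ (α q : ℕ) < α p := fun h => hp (mem_boundary.2 ⟨le_rfl, q, hq, h⟩)
  have h2 : (α q : ℕ) ≠ α p := fun h => hq.ne (eq_of_position_eq h.symm)
  have : q ∈ H.boundary α (α p + 1) := mem_boundary.2 ⟨by omega, p, hq.symm, by omega⟩
  simpa [hz] using this

/-- If the boundary is `{z}` and `z` is not the last vertex, then `z` has a neighbour outside
the initial segment. -/
lemma exists_adj_of_boundary_eq_singleton (hH : H.Connected) {z : W} {i : ℕ}
    (hi : i + 2 ≤ Fintype.card W) (hz : H.boundary α i = {z}) :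
    ∃ b, H.Adj z b ∧ i ≤ (α b : ℕ) := by
  obtain ⟨a, ha⟩ := exists_position (α := α) (i := i) (by omega)
  obtain ⟨b, hb⟩ := exists_position (α := α) (i := i + 1) (by omega)
  have : ∃ e, e ≠ z ∧ i ≤ (α e : ℕ) := by
    by_cases h : a = z
    · refine ⟨b, ?_, by omega⟩
      rintro rfl
      rw [h] at ha
      omega
    · exact ⟨a, h, by omega⟩
  obtain ⟨e, he, hei⟩ := this
  obtain ⟨c, hc, d, hd, hcd⟩ := hH.exists_adj_mem_notMem (S := {q | q = z ∨ (α q : ℕ) < i})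
    (a := z) (b := e) (Or.inl rfl) (by simp [he, hei])
  simp only [Set.mem_ofPred_eq, not_or, not_lt] at hc hd
  rcases hc with rfl | hc
  · exact ⟨d, hcd, hd.2⟩
  · have : d ∈ H.boundary α i := mem_boundary.2 ⟨hd.2, c, hcd.symm, hc⟩
    rw [hz, Finset.mem_singleton] at this
    exact absurd this hd.1

end Ordering

end SimpleGraph

namespace SimpleGraph

/-! ### Bridges and cuts with a single edge -/

variable {V : Type*} {K : SimpleGraph V}

/-- A bridge remains a bridge in every induced subgraph that contains its ends. -/
lemma IsBridge.induce {T : Set V} {a b : T} (h : K.IsBridge s((a : V), (b : V))) :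
    (K.induce T).IsBridge s(a, b) := by
  rw [isBridge_iff] at h ⊢
  refine fun hr => h (hr.map (⟨Subtype.val, ?_⟩ :
    ((K.induce T).deleteEdges {s(a, b)}) →g (K.deleteEdges {s((a : V), (b : V))})))
  intro c d hcd
  simp only [deleteEdges_adj, comap_adj, Function.Embedding.subtype_apply,
    Set.mem_singleton_iff] at hcd ⊢
  refine ⟨hcd.1, fun he => hcd.2 ?_⟩
  exact Sym2.map.injective Subtype.val_injective (by simpa using he)

/-- A vertex all of whose edges are bridges is a bridgeless component. -/
lemma isBridgelessComponent_singleton {v : V}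
    (h : ∀ a, K.Adj v a → K.IsBridge s(v, a)) : K.IsBridgelessComponent {v} := by
  refine ⟨⟨?_, ?_⟩, ?_⟩
  · have : Nonempty ({v} : Set V) := ⟨⟨v, rfl⟩⟩
    have : Subsingleton ({v} : Set V) := ⟨fun a b => Subtype.ext (a.2.trans b.2.symm)⟩
    exact ⟨fun a b => by rw [Subsingleton.elim a b]⟩
  · intro e
    induction e with
    | _ a b =>
      intro he
      rw [mem_edgeSet] at he
      exact absurd (Subtype.ext (a.2.trans b.2.symm)) he.ne
  · rintro T ⟨hT, hb⟩ hvT w hw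
    have hv : v ∈ T := hvT rfl
    by_contra hne
    obtain ⟨c, hc, d, hd, hcd⟩ := hT.exists_adj_mem_notMem (S := {(⟨v, hv⟩ : T)})
      (a := ⟨v, hv⟩) (b := ⟨w, hw⟩) rfl (fun h => hne (congrArg Subtype.val h))
    obtain rfl : c = ⟨v, hv⟩ := hc
    exact hb _ ((mem_edgeSet _).2 hcd) (h d hcd).induce

/-- `xz` is an edge, and the only one, that leads from `S` to the complement of `S`. -/
structure IsSingleCut (K : SimpleGraph V) (S : Set V) (x z : V) : Prop where
  adj : K.Adj x z
  mem : x ∈ S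
  notMem : z ∉ S
  unique : ∀ a ∈ S, ∀ b ∉ S, K.Adj a b → a = x ∧ b = z

namespace IsSingleCut

variable {S : Set V} {x z : V}

lemma compl (h : K.IsSingleCut S x z) : K.IsSingleCut Sᶜ z x where
  adj := h.adj.symm
  mem := h.notMem
  notMem := fun h' => h' h.mem
  unique := fun a ha b hb hab => (h.unique b (not_not.1 hb) a ha hab.symm).symm

lemma mem_of_reachable (h : K.IsSingleCut S x z) {w : V}
    (hw : (K.deleteEdges {s(x, z)}).Reachable x w) : w ∈ S := by
  by_contra hwS
  obtain ⟨p⟩ := hw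
  obtain ⟨d, -, h1, h2⟩ := p.exists_boundary_dart S h.mem hwS
  have hd := d.adj
  rw [deleteEdges_adj] at hd
  obtain ⟨h3, h4⟩ := h.unique _ h1 _ h2 hd.1
  exact hd.2 (by rw [h3, h4]; rfl)

lemma isBridge (h : K.IsSingleCut S x z) : K.IsBridge s(x, z) :=
  isBridge_iff.2 fun hr => h.notMem (h.mem_of_reachable hr)

end IsSingleCut

/-- Every vertex of a connected graph is still connected to one of the ends of a deleted edge. -/
lemma Connected.reachable_deleteEdges_or (hK : K.Connected) (x z w : V) :
    (K.deleteEdges {s(x, z)}).Reachable x w ∨ (K.deleteEdges {s(x, z)}).Reachable z w := by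
  by_contra hw
  obtain ⟨c, hc, d, hd, hcd⟩ := hK.exists_adj_mem_notMem
    (S := {w | (K.deleteEdges {s(x, z)}).Reachable x w ∨ (K.deleteEdges {s(x, z)}).Reachable z w})
    (a := x) (b := w) (Or.inl (Reachable.refl _)) hw
  by_cases he : s(c, d) = s(x, z)
  · rcases Sym2.eq_iff.1 he with ⟨-, rfl⟩ | ⟨-, rfl⟩
    · exact hd (Or.inr (Reachable.refl _))
    · exact hd (Or.inl (Reachable.refl _))
  · have : (K.deleteEdges {s(x, z)}).Adj c d := (deleteEdges_adj).2 ⟨hcd, he⟩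
    exact hd (hc.imp (fun h => h.trans this.reachable) fun h => h.trans this.reachable)

end SimpleGraph

namespace WeightedGraph

/-! ### Degrees, and the applicability of the two reductions -/

variable {V : Type*} {G : WeightedGraph V}

lemma deg_ne_one_of_adj {x a b : V} (ha : G.graph.Adj x a) (hb : G.graph.Adj x b)
    (hab : a ≠ b) : G.deg x ≠ 1 := by
  intro h
  obtain ⟨c, hc⟩ := Set.ncard_eq_one.1 h
  have h1 : a ∈ G.graph.neighborSet x := ha
  have h2 : b ∈ G.graph.neighborSet x := hb
  rw [hc] at h1 h2
  exact hab (h1.trans h2.symm)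

lemma deg_eq_one_of_forall {x v : V} (hx : G.graph.Adj x v)
    (h : ∀ b, G.graph.Adj x b → b = v) : G.deg x = 1 := by
  have : G.graph.neighborSet x = {v} := by
    ext b
    exact ⟨fun hb => h b hb, fun hb => by rw [Set.mem_singleton_iff.1 hb]; exact hx⟩
  rw [deg, this, Set.ncard_singleton]

variable [Fintype V]

lemma one_lt_deg_of_adj {x a : V} (ha : G.graph.Adj x a) (h : G.deg x ≠ 1) : 1 < G.deg x := by
  have : 0 < G.deg x := (Set.ncard_pos (Set.toFinite _)).2 ⟨a, ha⟩
  omega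

lemma eq_of_adj_of_one_lt_weight {y a b : V} (hy : 1 < G.weight y) (ha : G.graph.Adj y a)
    (hb : G.graph.Adj y b) : a = b := by
  by_contra hab
  have := G.weight_eq_one y (one_lt_deg_of_adj ha (deg_ne_one_of_adj ha hb hab))
  omega

lemma weightOf_mono {S T : Set V} (h : S ⊆ T) : G.weightOf S ≤ G.weightOf T :=
  Finset.sum_le_sum fun _ _ => Set.indicator_le_indicator_of_subset h (fun _ => Nat.zero_le _) _

lemma ncard_neighborSet_induce_le {S : Set V} (u : S) :
    ((G.graph.induce S).neighborSet u).ncard ≤ G.deg u := by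
  rw [← Set.ncard_image_of_injective _ Subtype.val_injective]
  refine Set.ncard_le_ncard ?_ (Set.toFinite _)
  rintro _ ⟨b, hb, rfl⟩
  exact hb

lemma mergeApplies_of_two_le {x : V} (hx : 2 ≤ (G.leaves x).ncard) : G.MergeApplies := by
  classical
  obtain ⟨v₁, hv₁⟩ : (G.leaves x).Nonempty := (Set.ncard_pos (Set.toFinite _)).1 (by omega)
  refine ⟨(G.leaves x \ {v₁})ᶜ,
    { graph := G.graph.induce _
      weight := fun u => if (u : V) = v₁ then G.weightOf (G.leaves x) else G.weight u
      weight_pos := ?_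
      weight_eq_one := ?_ }, x, v₁, hx, hv₁, rfl, rfl, ?_⟩
  · intro u
    split_ifs
    · refine lt_of_lt_of_le (G.weight_pos v₁) ?_
      have := Finset.single_le_sum (f := fun v => (G.leaves x).indicator G.weight v)
        (fun _ _ => Nat.zero_le _) (Finset.mem_univ v₁)
      simpa [weightOf, hv₁] using this
    · exact G.weight_pos u
  · intro u hu
    have hle := hu.trans_le (ncard_neighborSet_induce_le u)
    rw [if_neg, G.weight_eq_one u hle]
    intro h
    rw [h, hv₁.2] at hle
    omega
  · exact fun u => ⟨fun h => if_pos h, fun h => if_neg h⟩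

lemma suppressApplies_of_isSuppressible {k : ℕ} {v : V} (hv : G.IsSuppressible k v) :
    G.SuppressApplies k := by
  obtain ⟨x, y, hxy, hN⟩ := Set.ncard_eq_two.1 hv.2.2.1
  have hx : x ∈ G.heavyNeighbors k v := by simp [hN]
  have hy : y ∈ G.heavyNeighbors k v := by simp [hN]
  -- Both ends of the new edge have weight `1`, so the new graph is a weighted graph.
  have hwx := G.weight_eq_one x (one_lt_deg_of_adj hx.1.1.symm hx.2.1)
  have hwy := G.weight_eq_one y (one_lt_deg_of_adj hy.1.1.symm hy.2.1)
  refine ⟨(insert v (G.leaves v))ᶜ,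
    { graph :=
        { Adj := fun a b => G.graph.Adj a b ∨ ((a : V) = x ∧ (b : V) = y) ∨
            ((a : V) = y ∧ (b : V) = x)
          symm := ⟨?_⟩
          loopless := ⟨?_⟩ }
      weight := fun a => G.weight a
      weight_pos := fun a => G.weight_pos a
      weight_eq_one := ?_ }, v, x, y, hv, hxy, hN, rfl, fun _ _ => Iff.rfl, fun _ => rfl⟩
  · rintro a b (h | h | h)
    · exact Or.inl h.symm
    · exact Or.inr (Or.inr h.symm)
    · exact Or.inr (Or.inl h.symm)
  · rintro a (h | h | h)
    · exact G.graph.irrefl h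
    · exact hxy (h.1.symm.trans h.2)
    · exact hxy (h.2.symm.trans h.1)
  · intro a ha
    by_cases hax : (a : V) = x
    · rw [hax, hwx]
    by_cases hay : (a : V) = y
    · rw [hay, hwy]
    refine G.weight_eq_one a (ha.trans_le ?_)
    rw [← Set.ncard_image_of_injective _ Subtype.val_injective]
    refine Set.ncard_le_ncard ?_ (Set.toFinite _)
    rintro _ ⟨b, hb | hb | hb, rfl⟩
    · exact hb
    · exact absurd hb.1 hax
    · exact absurd hb.1 hay

/-- The order of a bridge that is the only edge between `S` and its complement is determined by
the weights of these two sets. -/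
lemma le_bridgeOrder_of_isSingleCut (hG : G.graph.Connected) {S : Set V} {x z : V} {k : ℕ}
    (h : G.graph.IsSingleCut S x z) (h1 : k ≤ G.weightOf S) (h2 : k ≤ G.weightOf Sᶜ) :
    k ≤ G.bridgeOrder x z := by
  have hzx : (G.graph.deleteEdges {s(z, x)}) = G.graph.deleteEdges {s(x, z)} := by
    rw [Sym2.eq_swap]
  refine le_min (h1.trans (weightOf_mono fun w hw => ?_)) (h2.trans (weightOf_mono fun w hw => ?_))
  · refine (hG.reachable_deleteEdges_or x z w).resolve_right fun hr => ?_
    exact h.compl.mem_of_reachable (hzx ▸ hr) hw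
  · change (G.graph.deleteEdges {s(z, x)}).Reachable z w
    rw [hzx]
    exact (hG.reachable_deleteEdges_or x z w).resolve_left fun hr => hw (h.mem_of_reachable hr)

/-- `xz` is the only edge between `S` and its complement, both of these have weight at least `k`,
and neither `x` nor `z` has degree `1`. -/
structure IsHeavyCut (G : WeightedGraph V) (k : ℕ) (S : Set V) (x z : V) : Prop
    extends G.graph.IsSingleCut S x z where
  le_weightOf : k ≤ G.weightOf S
  le_weightOf_compl : k ≤ G.weightOf Sᶜ
  deg_left : G.deg x ≠ 1
  deg_right : G.deg z ≠ 1

lemma IsHeavyCut.compl {k : ℕ} {S : Set V} {x z : V} (h : G.IsHeavyCut k S x z) :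
    G.IsHeavyCut k Sᶜ z x where
  toIsSingleCut := h.toIsSingleCut.compl
  le_weightOf := h.le_weightOf_compl
  le_weightOf_compl := by rw [compl_compl]; exact h.le_weightOf
  deg_left := h.deg_right
  deg_right := h.deg_left

lemma IsHeavyCut.mem_heavyNeighbors (hG : G.graph.Connected) {k : ℕ} {S : Set V} {x z : V}
    (h : G.IsHeavyCut (k + 2) S x z) : z ∈ G.heavyNeighbors k x :=
  ⟨⟨h.adj, h.isBridge⟩, h.deg_right,
    le_bridgeOrder_of_isSingleCut hG h.toIsSingleCut h.le_weightOf h.le_weightOf_compl⟩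

/-- If two nested heavy cuts `xv` and `vy` enclose only `v` and vertices of degree `1`
hanging on `v`, then `v` is suppressible. -/
lemma isSuppressible_of_isHeavyCut (hG : G.graph.Connected) {k : ℕ} {S T : Set V} {x v y : V}
    (hS : G.IsHeavyCut (k + 2) S x v) (hT : G.IsHeavyCut (k + 2) T v y) (hST : S ⊆ T)
    (hmid : ∀ a ∈ T, a ∉ S → a ≠ v → ∀ b, G.graph.Adj a b → b = v)
    (hleaf : (G.leaves v).ncard ≤ 1) : G.IsSuppressible k v := by
  have hxy : x ≠ y := fun h => hT.notMem (h ▸ hST hS.mem)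
  have hnbr : ∀ a, G.graph.Adj v a → a = x ∨ a = y ∨ a ∈ G.leaves v := by
    intro a ha
    by_cases haS : a ∈ S
    · exact Or.inl (hS.unique a haS v hS.notMem ha.symm).1
    by_cases haT : a ∈ T
    · exact Or.inr (Or.inr ⟨ha, deg_eq_one_of_forall ha.symm (hmid a haT haS ha.ne')⟩)
    · exact Or.inr (Or.inl (hT.unique v hT.mem a haT ha).2)
  have hN : G.heavyNeighbors k v = {x, y} := by
    ext a
    constructor
    · intro ha
      rcases hnbr a ha.1.1 with h | h | h
      · exact Or.inl h
      · exact Or.inr h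
      · exact absurd h.2 ha.2.1
    · rintro (rfl | rfl)
      · exact hS.compl.mem_heavyNeighbors hG
      · exact hT.mem_heavyNeighbors hG
  have hnb : G.graph.neighborSet v = {x, y} ∪ G.leaves v := by
    ext a
    constructor
    · intro ha
      rcases hnbr a ha with h | h | h
      · exact Or.inl (Or.inl h)
      · exact Or.inl (Or.inr h)
      · exact Or.inr h
    · rintro ((rfl | rfl) | h)
      · exact hS.adj.symm
      · exact hT.adj
      · exact h.1
  refine ⟨SimpleGraph.isBridgelessComponent_singleton fun a ha => ?_, ?_, ?_, ?_⟩
  · rcases hnbr a ha with rfl | rfl | h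
    · exact hS.compl.isBridge
    · exact hT.isBridge
    · have : G.graph.IsSingleCut {a} a v :=
        { adj := ha.symm
          mem := rfl
          notMem := ha.ne
          unique := by
            rintro _ rfl b - hab
            exact ⟨rfl, by_contra fun hb => deg_ne_one_of_adj hab ha.symm hb h.2⟩ }
      exact Sym2.eq_swap ▸ this.isBridge
  · have h2 : ({x, y} : Set V).ncard = 2 := Set.ncard_pair hxy
    have hle := Set.ncard_union_le {x, y} (G.leaves v)
    have hge := Set.ncard_le_ncard (Set.subset_union_left (s := {x, y}) (t := G.leaves v))
      (Set.toFinite _)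
    rw [deg, hnb]
    omega
  · rw [hN, Set.ncard_pair hxy]
  · intro w hw hwN
    rcases hnbr w hw with rfl | rfl | h
    · exact absurd (by simp [hN]) hwN
    · exact absurd (by simp [hN]) hwN
    · exact h.2

end WeightedGraph

namespace WeightedGraph

/-! ### The expanded graph -/

section Expand

variable {V : Type*} {G : WeightedGraph V}

/-- The copy number `0` of a vertex. -/
def copyZero (G : WeightedGraph V) (v : V) : Σ v : V, Fin (G.weight v) := ⟨v, 0, G.weight_pos v⟩

lemma exists_adj [Nontrivial V] (hG : G.graph.Connected) (v : V) : ∃ w, G.graph.Adj v w :=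
  hG.preconnected.exists_adj_of_nontrivial v

lemma connected_expand [Nontrivial V] (hG : G.graph.Connected) : G.expand.Connected := by
  have hzero : ∀ p : Σ v : V, Fin (G.weight v), G.expand.Reachable p (G.copyZero p.1) := by
    rintro ⟨v, c⟩
    obtain ⟨w, hw⟩ := exists_adj hG v
    have h1 : G.expand.Adj ⟨v, c⟩ (G.copyZero w) := hw
    have h2 : G.expand.Adj (G.copyZero w) (G.copyZero v) := hw.symm
    exact h1.reachable.trans h2.reachable
  have hmap : ∀ v w, G.graph.Reachable v w → G.expand.Reachable (G.copyZero v) (G.copyZero w) :=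
    fun v w h => h.map ⟨G.copyZero, fun h => h⟩
  have : Nonempty (Σ v : V, Fin (G.weight v)) := hG.nonempty.map G.copyZero
  exact ⟨fun p q => ((hzero p).trans (hmap _ _ (hG.preconnected _ _))).trans (hzero q).symm⟩

lemma eq_copyZero {p : Σ v : V, Fin (G.weight v)} {v : V} (h : p.1 = v) (hv : G.weight v = 1) :
    p = G.copyZero v := by
  obtain ⟨w, c⟩ := p
  obtain rfl : w = v := h
  have : Subsingleton (Fin (G.weight w)) := by rw [hv]; infer_instance
  exact congrArg (Sigma.mk w) (Subsingleton.elim _ _)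

variable [Fintype V]

lemma card_expand : Fintype.card (Σ v : V, Fin (G.weight v)) = G.totalWeight := by
  simp [totalWeight]

lemma weightOf_eq_card (S : Set V) [DecidablePred fun p : Σ v : V, Fin (G.weight v) => p.1 ∈ S] :
    G.weightOf S = (Finset.univ.filter fun p : Σ v : V, Fin (G.weight v) => p.1 ∈ S).card := by
  classical
  have : (Finset.univ.filter fun p : Σ v : V, Fin (G.weight v) => p.1 ∈ S)
      = (Finset.univ.filter fun v => v ∈ S).sigma fun _ => Finset.univ := by
    ext p
    simp
  rw [this, Finset.card_sigma, weightOf, Finset.sum_filter]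
  simp [Set.indicator_apply]

/-- If at least three vertices are connected, then a neighbour of a vertex of weight at least two
has weight one: otherwise these two vertices would form a component. -/
lemma weight_eq_one_of_adj (hG : G.graph.Connected) (hV : 3 ≤ Fintype.card V) {y x : V}
    (hy : 1 < G.weight y) (hyx : G.graph.Adj y x) : G.weight x = 1 := by
  classical
  by_contra hx
  have hx1 : 1 < G.weight x := by have := G.weight_pos x; omega
  obtain ⟨b, hb⟩ : ∃ b, b ∉ ({y, x} : Finset V) := by
    by_contra! h
    have h2 : Fintype.card V ≤ ({y, x} : Finset V).card :=
      Finset.card_le_card fun v _ => h v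
    have := Finset.card_le_two (a := y) (b := x)
    omega
  obtain ⟨c, hc, d, hd, hcd⟩ := hG.exists_adj_mem_notMem (S := ({y, x} : Finset V))
    (a := y) (b := b) (by simp) (by simpa using hb)
  simp only [Finset.coe_insert, Finset.coe_singleton, Set.mem_insert_iff,
    Set.mem_singleton_iff, not_or] at hc hd
  rcases hc with rfl | rfl
  · exact hd.2 (eq_of_adj_of_one_lt_weight hy hcd hyx)
  · exact hd.1 (eq_of_adj_of_one_lt_weight hx1 hcd hyx.symm)

/-- Counting edges: besides one edge for each edge of `G`, the expanded graph has an edge for each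
copy with a nonzero number, and all these edges are counted in the profile. -/
lemma ncard_edgeSet_add_le [Nontrivial V] (hG : G.graph.Connected)
    (α : (Σ v : V, Fin (G.weight v)) ≃ Fin (Fintype.card (Σ v : V, Fin (G.weight v)))) :
    G.graph.edgeSet.ncard + G.totalWeight ≤ G.expand.orderingProfile α + Fintype.card V := by
  classical
  set B := Finset.univ.filter fun e : (Σ v : V, Fin (G.weight v)) × Σ v : V, Fin (G.weight v) =>
    G.expand.Adj e.1 e.2 ∧ α e.2 < α e.1 with hB
  have hBle : B.card ≤ G.expand.orderingProfile α := G.expand.card_back_pairs_le α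
  -- Every edge has an ordered pair of copies, in one order or the other, in `B`.
  have hmem : ∀ p q : Σ v : V, Fin (G.weight v), G.graph.Adj p.1 q.1 → (p, q) ∈ B ∨ (q, p) ∈ B := by
    intro p q h
    have hne : α p ≠ α q := fun he => h.ne (congrArg Sigma.fst (α.injective he))
    rcases lt_or_gt_of_ne hne with hlt | hlt
    · exact Or.inr (by rw [hB, Finset.mem_filter]; exact ⟨Finset.mem_univ _, h.symm, hlt⟩)
    · exact Or.inl (by rw [hB, Finset.mem_filter]; exact ⟨Finset.mem_univ _, h, hlt⟩)
  let P : (Σ v : V, Fin (G.weight v)) → Prop := fun p => p = G.copyZero p.1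
  have hP : ∀ v, P (G.copyZero v) := fun _ => rfl
  have h1 : G.graph.edgeSet.ncard ≤ (B.filter fun e => P e.1 ∧ P e.2).card := by
    rw [← Set.ncard_coe_finset]
    refine le_trans (Set.ncard_le_ncard ?_ (Set.toFinite _))
      (Set.ncard_image_le (f := fun e => s(e.1.1, e.2.1)) (Set.toFinite _))
    intro e
    induction e with
    | _ a b =>
      intro hab
      rcases hmem (G.copyZero a) (G.copyZero b) hab with h | h
      · exact ⟨_, Finset.mem_coe.2 (Finset.mem_filter.2 ⟨h, hP a, hP b⟩), rfl⟩
      · exact ⟨_, Finset.mem_coe.2 (Finset.mem_filter.2 ⟨h, hP b, hP a⟩), Sym2.eq_swap⟩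
  have h2 : (Finset.univ.filter fun p : Σ v : V, Fin (G.weight v) => ¬ P p).card
      ≤ (B.filter fun e => ¬ (P e.1 ∧ P e.2)).card := by
    refine Finset.card_le_card_of_surjOn (fun e => if P e.1 then e.2 else e.1) ?_
    intro p hp
    have hp : ¬ P p := by simpa using hp
    obtain ⟨w, hw⟩ := exists_adj hG p.1
    rcases hmem p (G.copyZero w) hw with h | h
    · exact ⟨_, Finset.mem_coe.2 (Finset.mem_filter.2 ⟨h, fun h' => hp h'.1⟩), if_neg hp⟩
    · exact ⟨_, Finset.mem_coe.2 (Finset.mem_filter.2 ⟨h, fun h' => hp h'.2⟩), if_pos (hP w)⟩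
  have h3 := Finset.card_filter_add_card_filter_not (s := B) fun e => P e.1 ∧ P e.2
  have h4 := Finset.card_filter_add_card_filter_not
    (s := (Finset.univ : Finset (Σ v : V, Fin (G.weight v)))) P
  have h5 : (Finset.univ.filter P).card ≤ Fintype.card V := by
    refine Finset.card_le_card_of_injOn Sigma.fst (fun _ _ => Finset.mem_univ _) ?_
    intro p hp q hq h
    have hp : P p := by simpa using hp
    have hq : P q := by simpa using hq
    rw [show p = G.copyZero p.1 from hp, show q = G.copyZero q.1 from hq, show p.1 = q.1 from h]
  rw [Finset.card_univ, card_expand] at h4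
  omega

end Expand

/-! ### Steps of an ordering of the expanded graph -/

section Steps

variable {V : Type*} [Fintype V] {G : WeightedGraph V}
  {α : (Σ v : V, Fin (G.weight v)) ≃ Fin (Fintype.card (Σ v : V, Fin (G.weight v)))}

/-- If the boundary before `p` is placed is `{p}` and the boundary afterwards is `{z}`, then no
vertex has both copies up to `p` and copies after `p`. -/
lemma position_le_of_fst_eq (hG : G.graph.Connected) (hV : 3 ≤ Fintype.card V)
    {p z q r : Σ v : V, Fin (G.weight v)}
    (hcard : (α p : ℕ) + 3 ≤ Fintype.card (Σ v : V, Fin (G.weight v)))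
    (hp : G.expand.boundary α (α p) = {p}) (hz : G.expand.boundary α (α p + 1) = {z})
    (hq : (α q : ℕ) ≤ α p) (hr : r.1 = q.1) : (α r : ℕ) ≤ α p := by
  have : Nontrivial V := Fintype.one_lt_card_iff_nontrivial.1 (by omega)
  by_contra! hrp
  have hw : 1 < G.weight q.1 := by
    have := G.weight_pos q.1
    by_contra hle
    have h1 : G.weight q.1 = 1 := by omega
    rw [eq_copyZero hr h1, ← eq_copyZero rfl h1] at hrp
    omega
  obtain ⟨x, hx⟩ := exists_adj hG q.1
  have hx1 := weight_eq_one_of_adj hG hV hw hx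
  -- The only neighbour of a copy of `q.1` is the only copy of `x`.
  have honly : ∀ s t : Σ v : V, Fin (G.weight v), s.1 = q.1 → G.expand.Adj s t →
      t = G.copyZero x := fun s t hs hst =>
    eq_copyZero (eq_of_adj_of_one_lt_weight hw (hs ▸ hst) hx) hx1
  by_cases hxp : (α (G.copyZero x) : ℕ) ≤ α p
  · have hrz : r ∈ G.expand.boundary α (α p + 1) :=
      SimpleGraph.mem_boundary.2 ⟨hrp, G.copyZero x,
        show G.graph.Adj r.1 x by rw [hr]; exact hx, by omega⟩
    rw [hz, Finset.mem_singleton] at hrz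
    obtain ⟨b, hb, hbp⟩ := SimpleGraph.exists_adj_of_boundary_eq_singleton
      (connected_expand hG) (by omega) hz
    rw [honly z b (hrz ▸ hr) hb] at hbp
    omega
  · have hxz : ∀ i, (α q : ℕ) < i → i ≤ (α p + 1 : ℕ) →
        G.copyZero x ∈ G.expand.boundary α i := fun i h1 h2 =>
      SimpleGraph.mem_boundary.2 ⟨by omega, q, hx.symm, h1⟩
    rcases Nat.lt_or_ge (α q : ℕ) (α p) with hlt | hge
    · have := hxz _ hlt (by omega)
      rw [hp, Finset.mem_singleton] at this
      rw [this] at hxp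
      exact hxp le_rfl
    · obtain rfl : q = p := SimpleGraph.eq_of_position_eq (le_antisymm hq hge)
      have hmem : q ∈ G.expand.boundary α (α q) := by simp [hp]
      obtain ⟨-, s, hs, hsq⟩ := SimpleGraph.mem_boundary.1 hmem
      rw [honly q s rfl hs] at hsq
      omega

/-- If the boundary before `p` is placed is `{p}` and the boundary afterwards is `{z}`, then the
edge from `p` to `z` is a cut of `G`. -/
lemma isHeavyCut_of_boundary (hG : G.graph.Connected) (hV : 3 ≤ Fintype.card V) {k : ℕ}
    {p z : Σ v : V, Fin (G.weight v)} (hk : k ≤ α p + 1)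
    (hcard : (α p : ℕ) + k + 1 ≤ Fintype.card (Σ v : V, Fin (G.weight v))) (hk2 : 2 ≤ k)
    (hp : G.expand.boundary α (α p) = {p}) (hz : G.expand.boundary α (α p + 1) = {z}) :
    G.IsHeavyCut k {v | ∃ q : Σ v : V, Fin (G.weight v), q.1 = v ∧ (α q : ℕ) ≤ α p} p.1 z.1 := by
  classical
  have : Nontrivial V := Fintype.one_lt_card_iff_nontrivial.1 (by omega)
  set S : Set V := {v | ∃ q : Σ v : V, Fin (G.weight v), q.1 = v ∧ (α q : ℕ) ≤ α p} with hS
  have hmem : ∀ r : Σ v : V, Fin (G.weight v), r.1 ∈ S ↔ (α r : ℕ) ≤ α p := by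
    intro r
    constructor
    · rintro ⟨q, hq, hqp⟩
      exact position_le_of_fst_eq hG hV (by omega) hp hz hqp hq.symm
    · exact fun h => ⟨r, rfl, h⟩
  have hunique : ∀ q r : Σ v : V, Fin (G.weight v), (α q : ℕ) ≤ α p → ¬ (α r : ℕ) ≤ α p →
      G.graph.Adj q.1 r.1 → q = p ∧ r = z := by
    intro q r hq hr hqr
    constructor
    · by_contra hne
      have : (α q : ℕ) ≠ α p := fun h => hne (SimpleGraph.eq_of_position_eq h)
      have : r ∈ G.expand.boundary α (α p) :=
        SimpleGraph.mem_boundary.2 ⟨by omega, q, hqr.symm, by omega⟩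
      rw [hp, Finset.mem_singleton] at this
      exact hr (by rw [this])
    · have : r ∈ G.expand.boundary α (α p + 1) :=
        SimpleGraph.mem_boundary.2 ⟨by omega, q, hqr.symm, by omega⟩
      rwa [hz, Finset.mem_singleton] at this
  have hzmem : z ∈ G.expand.boundary α (α p + 1) := by simp [hz]
  obtain ⟨hzp, q, hzq, hqp⟩ := SimpleGraph.mem_boundary.1 hzmem
  have hzS : z.1 ∉ S := fun h => by have := (hmem z).1 h; omega
  have hpz : G.graph.Adj p.1 z.1 := by
    obtain ⟨rfl, -⟩ := hunique q z (by omega) (by omega) hzq.symm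
    exact hzq.symm
  have hpmem : p ∈ G.expand.boundary α (α p) := by simp [hp]
  obtain ⟨-, s, hps, hsp⟩ := SimpleGraph.mem_boundary.1 hpmem
  obtain ⟨b, hzb, hbp⟩ := SimpleGraph.exists_adj_of_boundary_eq_singleton
    (connected_expand hG) (by omega) hz
  have hpS : p.1 ∈ S := (hmem p).2 le_rfl
  have hbS : b.1 ∉ S := fun h => by have := (hmem b).1 h; omega
  have hcount : G.weightOf S = α p + 1 := by
    refine (weightOf_eq_card S).trans ((Finset.card_bij (t := Finset.range (α p + 1))
      (fun r _ => (α r : ℕ)) ?_ ?_ ?_).trans (Finset.card_range _))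
    · intro r hr
      have := (hmem r).1 (Finset.mem_filter.1 hr).2
      exact Finset.mem_range.2 (by omega)
    · exact fun r _ t _ h => SimpleGraph.eq_of_position_eq h
    · intro i hi
      have hi := Finset.mem_range.1 hi
      obtain ⟨r, hr⟩ := SimpleGraph.exists_position (α := α) (i := i) (by omega)
      exact ⟨r, Finset.mem_filter.2 ⟨Finset.mem_univ _, (hmem r).2 (by omega)⟩, hr⟩
  have hcompl : G.weightOf S + G.weightOf Sᶜ = G.totalWeight := by
    rw [weightOf, weightOf, ← Finset.sum_add_distrib, totalWeight]
    exact Finset.sum_congr rfl fun v _ => Set.indicator_self_add_compl_apply S G.weight v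
  have hN := card_expand (G := G)
  exact
    { adj := hpz
      mem := hpS
      notMem := hzS
      unique := by
        rintro _ ⟨q, rfl, hq⟩ b hb hqb
        have hb' : ¬ (α (G.copyZero b) : ℕ) ≤ α p := fun h => hb ((hmem (G.copyZero b)).2 h)
        obtain ⟨h1, h2⟩ := hunique q (G.copyZero b) hq hb' hqb
        exact ⟨congrArg Sigma.fst h1, congrArg Sigma.fst h2⟩
      le_weightOf := by omega
      le_weightOf_compl := by omega
      deg_left := deg_ne_one_of_adj hps hpz fun h =>
        hzS (h ▸ (hmem s).2 hsp.le)
      deg_right := deg_ne_one_of_adj hpz.symm hzb fun h => hbS (h ▸ hpS) }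

/-- Between two successive steps that place a boundary vertex only vertices of degree `1` are
placed if all boundaries are singletons; the vertex placed in the second of these steps is then
suppressible. -/
lemma exists_isSuppressible (hG : G.graph.Connected) (hV : 3 ≤ Fintype.card V) {k : ℕ}
    {p q : Σ v : V, Fin (G.weight v)} (hpq : (α p : ℕ) < α q) (hk : k + 2 ≤ α p + 1)
    (hcard : (α q : ℕ) + k + 3 ≤ Fintype.card (Σ v : V, Fin (G.weight v)))
    (hd : ∀ l, (α p : ℕ) ≤ l → l ≤ α q + 1 → (G.expand.boundary α l).card = 1)
    (hp : p ∈ G.expand.boundary α (α p)) (hq : q ∈ G.expand.boundary α (α q))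
    (hmid : ∀ r, (α p : ℕ) < α r → (α r : ℕ) < α q → r ∉ G.expand.boundary α (α r))
    (hleaf : ∀ v, (G.leaves v).ncard ≤ 1) : G.IsSuppressible k q.1 := by
  obtain ⟨z, hz⟩ := Finset.card_eq_one.1 (hd (α p + 1) (by omega) (by omega))
  obtain ⟨y, hy⟩ := Finset.card_eq_one.1 (hd (α q + 1) (by omega) (by omega))
  obtain ⟨p', hp'⟩ := Finset.card_eq_one.1 (hd (α p) (by omega) (by omega))
  have hconst : ∀ l, (α p : ℕ) + 1 ≤ l → l ≤ α q → G.expand.boundary α l = {z} := fun l h1 h2 =>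
    SimpleGraph.boundary_eq_of_forall_notMem h1 hz (fun l' _ _ => hd l' (by omega) (by omega))
      fun r _ _ => hmid r (by omega) (by omega)
  have hqz : G.expand.boundary α (α q) = {z} := hconst _ hpq le_rfl
  obtain rfl : p = p' := by simpa [hp'] using hp
  obtain rfl : q = z := by simpa [hqz] using hq
  refine isSuppressible_of_isHeavyCut hG
    (isHeavyCut_of_boundary hG hV (by omega) (by omega) (by omega) hp' hz)
    (isHeavyCut_of_boundary hG hV (by omega) (by omega) (by omega) hqz hy) ?_ ?_ (hleaf _)
  · rintro _ ⟨r, rfl, hr⟩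
    exact ⟨r, rfl, by omega⟩
  · rintro _ ⟨r, rfl, hr⟩ hrp hrq b hb
    have h1 : ¬ (α r : ℕ) ≤ α p := fun h => hrp ⟨r, rfl, h⟩
    have h2 : (α r : ℕ) ≠ α q := fun h => hrq (by rw [SimpleGraph.eq_of_position_eq h])
    have hb' : G.expand.Adj r (G.copyZero b) := hb
    exact congrArg Sigma.fst (SimpleGraph.eq_of_adj_of_notMem_boundary
      (hmid r (by omega) (by omega)) (hconst _ (by omega) (by omega)) hb')

/-- If all boundaries around two steps are singletons, and no boundary vertex is placed from the
first of the steps to the second, then both steps place copies of the same vertex, a vertex of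
degree `1` hanging on the common boundary vertex. -/
lemma fst_eq_of_forall_notMem_boundary [Nontrivial V] (hG : G.graph.Connected)
    {p q : Σ v : V, Fin (G.weight v)} (hpq : (α p : ℕ) < α q)
    (hd : ∀ l, (α p : ℕ) ≤ l → l ≤ α q + 1 → (G.expand.boundary α l).card = 1)
    (hmid : ∀ r, (α p : ℕ) ≤ α r → (α r : ℕ) ≤ α q → r ∉ G.expand.boundary α (α r))
    (hleaf : ∀ v, (G.leaves v).ncard ≤ 1) : p.1 = q.1 := by
  obtain ⟨z, hz⟩ := Finset.card_eq_one.1 (hd (α p) le_rfl (by omega))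
  have hconst : ∀ l, (α p : ℕ) ≤ l → l ≤ α q + 1 → G.expand.boundary α l = {z} := fun l h1 h2 =>
    SimpleGraph.boundary_eq_of_forall_notMem h1 hz (fun l' _ _ => hd l' (by omega) (by omega))
      fun r _ _ => hmid r (by omega) (by omega)
  have hmem : ∀ r, (α p : ℕ) ≤ α r → (α r : ℕ) ≤ α q → r.1 ∈ G.leaves z.1 := by
    intro r h1 h2
    have hN : ∀ b, G.graph.Adj r.1 b → b = z.1 := fun b hb => by
      have hb' : G.expand.Adj r (G.copyZero b) := hb
      exact congrArg Sigma.fst (SimpleGraph.eq_of_adj_of_notMem_boundary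
        (hmid r h1 h2) (hconst _ (by omega) (by omega)) hb')
    obtain ⟨b, hb⟩ := exists_adj hG r.1
    have hrz : G.graph.Adj r.1 z.1 := hN b hb ▸ hb
    exact ⟨hrz.symm, deg_eq_one_of_forall hrz hN⟩
  exact (Set.ncard_le_one (Set.toFinite _)).1 (hleaf z.1) _ (hmem p le_rfl hpq.le) _
    (hmem q hpq.le le_rfl)

/-- The position of the first copy of a vertex. -/
noncomputable def firstPosition
    (α : (Σ v : V, Fin (G.weight v)) ≃ Fin (Fintype.card (Σ v : V, Fin (G.weight v)))) (v : V) :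
    ℕ :=
  sInf {i | ∃ p : Σ v : V, Fin (G.weight v), p.1 = v ∧ (α p : ℕ) = i}

lemma exists_firstPosition (v : V) :
    ∃ p : Σ v : V, Fin (G.weight v), p.1 = v ∧ (α p : ℕ) = firstPosition α v :=
  Nat.sInf_mem (s := {i | ∃ p : Σ v : V, Fin (G.weight v), p.1 = v ∧ (α p : ℕ) = i})
    ⟨_, G.copyZero v, rfl, rfl⟩

lemma firstPosition_injective : Function.Injective (firstPosition α) := by
  intro v w h
  obtain ⟨p, rfl, hp⟩ := exists_firstPosition (α := α) v
  obtain ⟨q, rfl, hq⟩ := exists_firstPosition (α := α) w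
  rw [SimpleGraph.eq_of_position_eq (α := α) (p := p) (q := q) (by omega)]

end Steps

/-! ### The bound on the number of vertices -/

lemma card_le_of_orderingProfile_le {V : Type*} [Fintype V] {G : WeightedGraph V}
    (hG : G.graph.Connected) (hV : 3 ≤ Fintype.card V) {k : ℕ}
    (hleaf : ∀ v, (G.leaves v).ncard ≤ 1) (hsupp : ∀ v, ¬ G.IsSuppressible k v)
    (α : (Σ v : V, Fin (G.weight v)) ≃ Fin (Fintype.card (Σ v : V, Fin (G.weight v))))
    (hα : G.expand.orderingProfile α + 1 ≤ Fintype.card (Σ v : V, Fin (G.weight v)) + k) :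
    Fintype.card V ≤ 7 * k + 7 := by
  classical
  have : Nontrivial V := Fintype.one_lt_card_iff_nontrivial.1 (by omega)
  have hH := connected_expand hG
  obtain ⟨N, hN⟩ : ∃ N, N = Fintype.card (Σ v : V, Fin (G.weight v)) := ⟨_, rfl⟩
  -- The positions before which the boundary is not a singleton.
  set D := (Finset.range N).filter fun i => 2 ≤ (G.expand.boundary α i).card with hD
  have hDk : D.card ≤ k := by
    rw [hD, hN]
    exact SimpleGraph.card_large_boundary_le hH hα
  have hD1 : ∀ i, 0 < i → i < N → i ∉ D → (G.expand.boundary α i).card = 1 := by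
    intro i h0 hi hiD
    have h1 := (SimpleGraph.boundary_nonempty (α := α) hH h0 (hN ▸ hi)).card_pos
    have h2 : ¬ 2 ≤ (G.expand.boundary α i).card := fun h =>
      hiD (Finset.mem_filter.2 ⟨Finset.mem_range.2 hi, h⟩)
    omega
  -- The steps far from both ends of the ordering, between singleton boundaries.
  set M := (Finset.Ico (k + 2) (N - (k + 2))).filter fun i => i ∉ D ∧ i + 1 ∉ D with hM
  have hMmem : ∀ i, i ∈ M → (k + 2 ≤ i ∧ i + k + 3 ≤ N) ∧ i ∉ D ∧ i + 1 ∉ D := by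
    intro i hi
    obtain ⟨h1, h2⟩ := Finset.mem_filter.1 hi
    rw [Finset.mem_Ico] at h1
    exact ⟨⟨h1.1, by omega⟩, h2⟩
  have hcard1 : ∀ i ∈ M, ∀ j ∈ M, (∀ l ∈ D, ¬ (i < l ∧ l < j)) →
      ∀ l, i ≤ l → l ≤ j + 1 → (G.expand.boundary α l).card = 1 := by
    intro i hi j hj hij l h1 h2
    obtain ⟨⟨hi1, -⟩, hi3, -⟩ := hMmem i hi
    obtain ⟨⟨-, hj2⟩, hj3, hj4⟩ := hMmem j hj
    refine hD1 l (by omega) (by omega) fun hl => hij l hl ⟨?_, ?_⟩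
    · refine lt_of_le_of_ne h1 ?_
      rintro rfl
      exact hi3 hl
    · have : l ≠ j + 1 := by
        rintro rfl
        exact hj4 hl
      have : l ≠ j := by
        rintro rfl
        exact hj3 hl
      omega
  -- The steps in `M` that place a boundary vertex, and the other steps in `M` that place the first
  -- copy of a vertex.
  set B := M.filter fun i => ∃ p, (α p : ℕ) = i ∧ p ∈ G.expand.boundary α i with hB
  set L := M.filter fun i => (∃ v, firstPosition α v = i) ∧ i ∉ B with hL
  have hMB : ∀ i ∈ M, i ∉ B → ∀ p, (α p : ℕ) = i → p ∉ G.expand.boundary α (α p) :=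
    fun i hi hiB p hpi hp => hiB (Finset.mem_filter.2 ⟨hi, p, hpi, hpi ▸ hp⟩)
  have hconvex : ∀ i ∈ M, ∀ j ∈ M, (∀ l ∈ D, ¬ (i < l ∧ l < j)) → ∀ l, i < l → l < j → l ∈ M := by
    intro i hi j hj hij l h1 h2
    obtain ⟨⟨hi1, -⟩, -⟩ := hMmem i hi
    obtain ⟨⟨-, hj2⟩, hj3, -⟩ := hMmem j hj
    refine Finset.mem_filter.2 ⟨Finset.mem_Ico.2 ⟨by omega, by omega⟩,
      fun h => hij l h ⟨h1, h2⟩, fun h => ?_⟩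
    rcases Nat.lt_or_ge (l + 1) j with h3 | h3
    · exact hij _ h ⟨by omega, h3⟩
    · rw [show l + 1 = j by omega] at h
      exact hj3 h
  have hBD : B.card ≤ D.card + 1 := by
    refine Finset.card_le_of_interleaved fun i hi j hj hij hnone => ?_
    by_contra! hno
    obtain ⟨hiM, p, rfl, hp⟩ := Finset.mem_filter.1 hi
    obtain ⟨hjM, q, rfl, hq⟩ := Finset.mem_filter.1 hj
    have hno' : ∀ l ∈ D, ¬ ((α p : ℕ) < l ∧ l < α q) := fun l hl h =>
      absurd (hno l hl h.1) (by omega)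
    have h1 := (hMmem _ hiM).1
    have h2 := (hMmem _ hjM).1
    refine hsupp q.1 (exists_isSuppressible hG hV hij (by omega) (by omega)
      (hcard1 _ hiM _ hjM hno') hp hq (fun r hr1 hr2 => ?_) hleaf)
    exact hMB _ (hconvex _ hiM _ hjM hno' _ hr1 hr2) (fun h => hnone _ h ⟨hr1, hr2⟩) r rfl
  have hLD : L.card ≤ (D ∪ B).card + 1 := by
    refine Finset.card_le_of_interleaved fun i hi j hj hij _ => ?_
    by_contra! hno
    obtain ⟨hiM, ⟨v, hv⟩, hiB⟩ := Finset.mem_filter.1 hi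
    obtain ⟨hjM, ⟨w, hw⟩, hjB⟩ := Finset.mem_filter.1 hj
    obtain ⟨p, rfl, hp⟩ := exists_firstPosition (α := α) v
    obtain ⟨q, rfl, hq⟩ := exists_firstPosition (α := α) w
    obtain rfl : (α p : ℕ) = i := hp.trans hv
    obtain rfl : (α q : ℕ) = j := hq.trans hw
    have hno' : ∀ l ∈ D, ¬ ((α p : ℕ) < l ∧ l < α q) := fun l hl h =>
      absurd (hno l (Finset.mem_union_left _ hl) h.1) (by omega)
    have hpq : p.1 = q.1 := by
      refine fst_eq_of_forall_notMem_boundary hG hij (hcard1 _ hiM _ hjM hno') ?_ hleaf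
      intro r h1 h2
      rcases h1.eq_or_lt with h1 | h1
      · exact hMB _ hiM hiB r h1.symm
      rcases h2.eq_or_lt with h2 | h2
      · exact hMB _ hjM hjB r h2
      refine hMB _ (hconvex _ hiM _ hjM hno' _ h1 h2) (fun h => ?_) r rfl
      exact absurd (hno _ (Finset.mem_union_right _ h) h1) (by omega)
    rw [hpq, hw] at hv
    omega
  have hcover : Finset.univ.image (firstPosition α) ⊆
      (Finset.range (k + 2) ∪ Finset.Ico (N - (k + 2)) N) ∪ (D ∪ D.image (· - 1)) ∪ (B ∪ L) := by
    intro i hi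
    obtain ⟨v, -, hv⟩ := Finset.mem_image.1 hi
    obtain ⟨p, -, hp⟩ := exists_firstPosition (α := α) v
    have hiN : i < N := by rw [← hv, ← hp, hN]; exact (α p).isLt
    simp only [Finset.mem_union, Finset.mem_range, Finset.mem_Ico, Finset.mem_image]
    by_contra! h
    obtain ⟨⟨⟨h1, h2⟩, h3, h4⟩, h5, h6⟩ := h
    have hiM : i ∈ M := Finset.mem_filter.2 ⟨Finset.mem_Ico.2 ⟨by omega, by omega⟩, h3,
      fun h => h4 _ h (by omega)⟩
    exact h6 (Finset.mem_filter.2 ⟨hiM, ⟨v, hv⟩, h5⟩)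
  have hfinal := Finset.card_le_card hcover
  rw [Finset.card_image_of_injective _ firstPosition_injective, Finset.card_univ] at hfinal
  have u1 := Finset.card_union_le
    ((Finset.range (k + 2) ∪ Finset.Ico (N - (k + 2)) N) ∪ (D ∪ D.image (· - 1))) (B ∪ L)
  have u2 := Finset.card_union_le
    (Finset.range (k + 2) ∪ Finset.Ico (N - (k + 2)) N) (D ∪ D.image (· - 1))
  have u3 := Finset.card_union_le (Finset.range (k + 2)) (Finset.Ico (N - (k + 2)) N)
  have u4 := Finset.card_union_le D (D.image (· - 1))
  have u5 := Finset.card_union_le B L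
  have u6 := Finset.card_union_le D B
  have u7 : (D.image (· - 1)).card ≤ D.card := Finset.card_image_le
  rw [Finset.card_range, Nat.card_Ico] at u3
  omega

end WeightedGraph

open WeightedGraph in
theorem theorem4p4 {V : Type*} [Fintype V] (G : WeightedGraph V) (hG : G.graph.Connected)
    (k : ℕ) (hk : 0 < k) (hprf : (G.profile : ℤ) ≤ (G.totalWeight : ℤ) - 1 + k) :
    G.MergeApplies ∨ G.SuppressApplies k ∨
      (Fintype.card V ≤ 12 * k + 6 ∧ G.graph.edgeSet.ncard ≤ 13 * k + 5) := by
  by_cases hmerge : ∃ x, 2 ≤ (G.leaves x).ncard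
  · exact Or.inl (mergeApplies_of_two_le hmerge.choose_spec)
  by_cases hsupp : ∃ v, G.IsSuppressible k v
  · exact Or.inr (Or.inl (suppressApplies_of_isSuppressible hsupp.choose_spec))
  push Not at hmerge hsupp
  obtain ⟨α, hα⟩ := G.expand.exists_orderingProfile_eq
  change _ = G.profile at hα
  have hn : Fintype.card V ≤ 7 * k + 7 := by
    by_cases hV : 3 ≤ Fintype.card V
    · refine card_le_of_orderingProfile_le hG hV (fun v => ?_) hsupp α ?_
      · have := hmerge v
        omega
      · rw [card_expand]
        omega
    · omega
  have hm : G.graph.edgeSet.ncard + 1 ≤ Fintype.card V + k := by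
    by_cases hV : 1 < Fintype.card V
    · have : Nontrivial V := Fintype.one_lt_card_iff_nontrivial.1 hV
      have := ncard_edgeSet_add_le hG α
      omega
    · have hsub : Subsingleton V := Fintype.card_le_one_iff_subsingleton.1 (by omega)
      have : G.graph.edgeSet = ∅ := by
        rw [Subsingleton.elim G.graph ⊥, SimpleGraph.edgeSet_bot]
      rw [this, Set.ncard_empty]
      omega
  exact Or.inr (Or.inr ⟨by omega, by omega⟩)
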